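/- Let $(A_n)_{n\ge 0}$ be finite-dimensional associative unital $\mathbb{C}$-algebras, and suppose that $A=\bigoplus_{n\ge0}A_n$ also carries an external multiplication $\rho$, given by maps $\rho_{m,n}\colon A_m\otimes A_n\to A_{m+n}$, which makes it an associative graded $\mathbb{C}$-algebra with unit $1\in A_0$. Suppose that $A$ is a tower of algebras, that is: (1) $A_0\cong\mathbb{C}$ as $\mathbb{C}$-algebras; (2) every $\rho_{m,n}$ is an injective unital homomorphism of algebras (for the internal products of $A_m\otimes A_n$ and $A_{m+n}$); (3) $A_{m+n}$ is projective as a left and as a right $A_m\otimes A_n$-module, where $A_m\otimes A_n$ acts through $\rho_{m,n}$, for all $m,n$. Let $G_0(A_n)$ and $K_0(A_n)$ be the Grothendieck groups (with relations $[M]=[L]+[N]$ for short exact sequences $0\to L\to M\to N\to0$) of the finitely generated left $A_n$-modules and of the finitely generated projective left $A_n$-modules, respectively. Put $G(A)=\bigoplus_n G_0(A_n)$ and $K(A)=\bigoplus_n K_0(A_n)$. On each of $G(A)$ and $K(A)$ consider the multiplication and the comultiplication $$[M][N]=\bigl[\mathrm{Ind}_{A_m\otimes A_n}^{A_{m+n}}(M\otimes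 N)\bigr],\qquad \Delta[N]=\sum_{k+l=n}\bigl[\mathrm{Res}^{A_{n}}_{A_k\otimes A_l}N\bigr],$$ where in the first formula $M$ is an $A_m$-module and $N$ an $A_n$-module, and in the second $N$ is an $A_n$-module and the Grothendieck groups of $A_k\otimes A_l$ are identified with the tensor products of those of $A_k$ and $A_l$ through $[M]\otimes[N]\mapsto[M\otimes N]$. Consider the pairing $K(A)\times G(A)\to\mathbb{Z}$ with $\langle[P],[M]\rangle=\dim_{\mathbb{C}}\mathrm{Hom}_{A_n}(P,M)$ if $P$ and $M$ are both $A_n$-modules for the same $n$, and $0$ otherwise. Suppose that $G(A)$ and $K(A)$ form a pair of graded dual Hopf algebras, that is, both are Hopf algebras over $\mathbb{Z}$ with these multiplications and comultiplications, and under the pairing the multiplication and unit of each are dual to the comultiplication and counit of the other. Then $\dim_{\mathbb{C}} A_n=r^n\,n!$ for all $n\ge0$, where $r=\dim_{\mathbb{C}} A_1$. -/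

import Mathlib

open scoped TensorProduct DirectSum

universe u v w

noncomputable section

namespace AlgTower

/-! ### Finitely generated modules and Grothendieck groups -/

section Modules

variable (B : Type u) [Ring B] [Algebra ℂ B]

/-- A finitely generated left module over a `ℂ`-algebra `B`.  The compatible `ℂ`-vector space
structure, which the `B`-action determines, is recorded as part of the data. -/
structure FGMod : Type (u + 1) where
  carrier : Type u
  [addCommGroup : AddCommGroup carrier]
  [moduleC : Module ℂ carrier]
  [module : Module B carrier]
  [tower : IsScalarTower ℂ B carrier]
  [fg : Module.Finite B carrier]

variable {B}

instance : CoeSort (FGMod B) (Type u) := ⟨FGMod.carrier⟩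

attribute [instance] FGMod.addCommGroup FGMod.moduleC FGMod.module FGMod.tower FGMod.fg

instance [Module.Finite ℂ B] (M : FGMod B) : Module.Finite ℂ M := Module.Finite.trans B M

/-- Short exact sequences `0 → L → M → N → 0` of `B`-modules. -/
structure IsShortExact {L M N : FGMod B} (f : L →ₗ[B] M) (g : M →ₗ[B] N) : Prop where
  injective : Function.Injective f
  exact : Function.Exact f g
  surjective : Function.Surjective g

/-- The subgroup of relations `(M) - (L) - (N)`, one for each short exact sequence
`0 → L → M → N → 0` of modules in the class `P`. -/
def relations (P : FGMod B → Prop) : AddSubgroup (FreeAbelianGroup {M : FGMod B // P M}) :=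
  AddSubgroup.closure {x | ∃ (L M N : {M : FGMod B // P M}) (f : L.1 →ₗ[B] M.1)
    (g : M.1 →ₗ[B] N.1), IsShortExact f g ∧
      x = FreeAbelianGroup.of M - FreeAbelianGroup.of L - FreeAbelianGroup.of N}

/-- The Grothendieck group of the class `P` of finitely generated `B`-modules.  Isomorphic
modules have equal classes, see `Groth.cls_eq_of_equiv`, so it makes no difference whether the
generators are the modules or their isomorphism classes. -/
def Groth (P : FGMod B → Prop) : Type (u + 1) :=
  FreeAbelianGroup {M : FGMod B // P M} ⧸ relations P

instance (P : FGMod B → Prop) : AddCommGroup (Groth P) :=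
  inferInstanceAs (AddCommGroup (FreeAbelianGroup {M : FGMod B // P M} ⧸ relations P))

/-- The class `[M]` of a module. -/
def Groth.cls {P : FGMod B → Prop} (M : FGMod B) (hM : P M) : Groth P :=
  QuotientAddGroup.mk (FreeAbelianGroup.of ⟨M, hM⟩)

/-- The class of all finitely generated modules. -/
def allMod (_ : FGMod B) : Prop := True

/-- The class of all finitely generated projective modules. -/
def projMod (M : FGMod B) : Prop := Module.Projective B M

variable (B) in
/-- `G₀(B)`, the Grothendieck group of finitely generated modules. -/
abbrev G0 : Type (u + 1) := Groth (allMod (B := B))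

variable (B) in
/-- `K₀(B)`, the Grothendieck group of finitely generated projective modules. -/
abbrev K0 : Type (u + 1) := Groth (projMod (B := B))

theorem Groth.cls_exact {P : FGMod B → Prop} {L M N : FGMod B} (hL : P L) (hM : P M) (hN : P N)
    (f : L →ₗ[B] M) (g : M →ₗ[B] N) (h : IsShortExact f g) :
    Groth.cls M hM = Groth.cls L hL + Groth.cls N hN := by
  have : (QuotientAddGroup.mk (FreeAbelianGroup.of ⟨M, hM⟩ - FreeAbelianGroup.of ⟨L, hL⟩ -
      FreeAbelianGroup.of ⟨N, hN⟩) : Groth P) = 0 :=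
    (QuotientAddGroup.eq_zero_iff _).2
      (AddSubgroup.subset_closure ⟨⟨L, hL⟩, ⟨M, hM⟩, ⟨N, hN⟩, f, g, h, rfl⟩)
  have h2 : Groth.cls M hM - Groth.cls L hL - Groth.cls N hN = 0 := this
  rw [sub_sub, sub_eq_zero] at h2
  exact h2

theorem Groth.cls_eq_of_equiv {P : FGMod B → Prop} {M N : FGMod B} (hM : P M) (hN : P N)
    (e : M ≃ₗ[B] N) (hP : P ⟨PUnit⟩) : Groth.cls M hM = Groth.cls N hN := by
  have h0 : Groth.cls (P := P) ⟨PUnit⟩ hP = 0 := by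
    have := Groth.cls_exact (P := P) (L := ⟨PUnit⟩) (M := ⟨PUnit⟩) (N := ⟨PUnit⟩) hP hP hP 0 0
      ⟨fun _ _ _ => Subsingleton.elim _ _, fun x => ⟨fun _ => ⟨x, Subsingleton.elim _ _⟩,
        fun _ => Subsingleton.elim _ _⟩, fun x => ⟨x, Subsingleton.elim _ _⟩⟩
    simpa using this
  have := Groth.cls_exact (P := P) (L := ⟨PUnit⟩) hP hM hN 0 e.toLinearMap
    ⟨fun _ _ _ => Subsingleton.elim _ _, fun x => by
      constructor
      · intro hx
        exact ⟨0, by simpa using (e.map_eq_zero_iff.1 hx).symm⟩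
      · rintro ⟨y, rfl⟩
        simp, e.surjective⟩
  simpa [h0] using this

/-- A function on modules that is additive on short exact sequences extends to the Grothendieck
group. -/
def Groth.lift {P : FGMod B → Prop} {X : Type v} [AddCommGroup X]
    (F : ∀ M : FGMod B, P M → X)
    (hF : ∀ (L M N : FGMod B) (hL : P L) (hM : P M) (hN : P N) (f : L →ₗ[B] M) (g : M →ₗ[B] N),
      IsShortExact f g → F M hM = F L hL + F N hN) : Groth P →+ X :=
  QuotientAddGroup.lift (relations P) (FreeAbelianGroup.lift fun M => F M.1 M.2) <| by
    rw [relations, AddSubgroup.closure_le]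
    rintro _ ⟨L, M, N, f, g, h, rfl⟩
    simp [hF _ _ _ L.2 M.2 N.2 f g h]

@[simp]
theorem Groth.lift_cls {P : FGMod B → Prop} {X : Type v} [AddCommGroup X]
    (F : ∀ M : FGMod B, P M → X) (hF) (M : FGMod B) (hM : P M) :
    Groth.lift F hF (Groth.cls M hM) = F M hM :=
  FreeAbelianGroup.lift_apply_of (fun M : {M : FGMod B // P M} => F M.1 M.2) ⟨M, hM⟩

theorem Groth.hom_ext {P : FGMod B → Prop} {X : Type v} [AddCommGroup X] {f g : Groth P →+ X}
    (h : ∀ M hM, f (Groth.cls M hM) = g (Groth.cls M hM)) : f = g := by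
  refine QuotientAddGroup.addMonoidHom_ext _ ?_
  ext M
  exact h M.1 M.2

end Modules

/-! ### External tensor product of modules -/

section External

variable {B C : Type u} [Ring B] [Algebra ℂ B] [Ring C] [Algebra ℂ C]

/-- The action of `B ⊗ C` on `M ⊗ N`, `(b ⊗ c) • (m ⊗ n) = (b • m) ⊗ (c • n)`. -/
abbrev extModule (M N : Type u) [AddCommGroup M] [Module ℂ M] [Module B M] [IsScalarTower ℂ B M]
    [AddCommGroup N] [Module ℂ N] [Module C N] [IsScalarTower ℂ C N] :
    Module (B ⊗[ℂ] C) (M ⊗[ℂ] N) :=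
  Module.compHom (M ⊗[ℂ] N)
    (((Module.endTensorEndAlgHom (R := ℂ) (S := ℂ) (A := ℂ) (M := M) (N := N)).comp
      (Algebra.TensorProduct.map (Algebra.lsmul ℂ ℂ M) (Algebra.lsmul ℂ ℂ N))).toRingHom :
        B ⊗[ℂ] C →+* Module.End ℂ (M ⊗[ℂ] N))

theorem ext_smul_tmul (M N : Type u) [AddCommGroup M] [Module ℂ M] [Module B M]
    [IsScalarTower ℂ B M] [AddCommGroup N] [Module ℂ N] [Module C N] [IsScalarTower ℂ C N]
    (b : B) (c : C) (m : M) (n : N) :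
    letI := extModule (B := B) (C := C) M N
    (b ⊗ₜ[ℂ] c) • (m ⊗ₜ[ℂ] n) = (b • m) ⊗ₜ[ℂ] (c • n) := rfl

theorem ext_tower (M N : Type u) [AddCommGroup M] [Module ℂ M] [Module B M]
    [IsScalarTower ℂ B M] [AddCommGroup N] [Module ℂ N] [Module C N] [IsScalarTower ℂ C N] :
    letI := extModule (B := B) (C := C) M N
    IsScalarTower ℂ (B ⊗[ℂ] C) (M ⊗[ℂ] N) := by
  let _ := extModule (B := B) (C := C) M N
  refine ⟨fun z a x => ?_⟩
  change ((Module.endTensorEndAlgHom (R := ℂ) (S := ℂ) (A := ℂ) (M := M) (N := N)).comp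
      (Algebra.TensorProduct.map (Algebra.lsmul ℂ ℂ M) (Algebra.lsmul ℂ ℂ N))) (z • a) x = _
  rw [map_smul]
  rfl

variable [Module.Finite ℂ B] [Module.Finite ℂ C]

/-- The external tensor product `M ⊗ N` of a `B`-module and a `C`-module. -/
def FGMod.ext (M : FGMod B) (N : FGMod C) : FGMod (B ⊗[ℂ] C) :=
  letI := extModule (B := B) (C := C) M N
  haveI := ext_tower (B := B) (C := C) M N
  { carrier := M ⊗[ℂ] N
    fg := Module.Finite.of_restrictScalars_finite ℂ _ _ }

theorem ext_projective (M : FGMod B) (N : FGMod C) (hM : projMod M) (hN : projMod N) :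
    projMod (M.ext N) := by
  obtain ⟨s, hs⟩ := hM.out
  obtain ⟨t, ht⟩ := hN.out
  let j : (M × N →₀ B ⊗[ℂ] C) →ₗ[B ⊗[ℂ] C] (M.ext N) :=
    Finsupp.linearCombination (B ⊗[ℂ] C) fun p => (p.1 ⊗ₜ[ℂ] p.2 : M ⊗[ℂ] N)
  let k₀ : M ⊗[ℂ] N →ₗ[ℂ] (M × N →₀ B ⊗[ℂ] C) :=
    (finsuppTensorFinsupp ℂ ℂ B C M N).toLinearMap ∘ₗ
      TensorProduct.map (s.restrictScalars ℂ) (t.restrictScalars ℂ)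
  have hk₀ : ∀ (a : B ⊗[ℂ] C) (x : M.ext N), k₀ (a • x : M.ext N) = a • k₀ x := by
    intro a x
    induction a using TensorProduct.induction_on with
    | zero => rw [zero_smul, zero_smul]; exact map_zero k₀
    | add a b ha hb => 
      rw [add_smul, add_smul, ← ha, ← hb]; exact map_add k₀ _ _
    | tmul b c =>
      induction x using TensorProduct.induction_on with
      | zero => 
        have h0 : k₀ (0 : M ⊗[ℂ] N) = 0 := map_zero k₀
        rw [h0, smul_zero]
        refine Eq.trans (congrArg k₀ ?_) h0
        exact smul_zero (A := M.ext N) _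
      | add x y hx hy =>
        have h0 : k₀ (x + y) = k₀ x + k₀ y := map_add k₀ _ _
        rw [h0, smul_add, ← hx, ← hy]
        refine Eq.trans (congrArg k₀ ?_) (map_add k₀ _ _)
        exact smul_add (A := M.ext N) _ _ _
      | tmul m n =>
        refine Eq.trans (congrArg k₀ (ext_smul_tmul M N b c m n)) ?_
        ext ⟨i, l⟩
        simp [k₀, Algebra.TensorProduct.tmul_mul_tmul]
  let k : M.ext N →ₗ[B ⊗[ℂ] C] (M × N →₀ B ⊗[ℂ] C) :=
    { toFun := k₀, map_add' := map_add k₀, map_smul' := hk₀ }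
  have hj : ∀ (f : M →₀ B) (g : N →₀ C), j (finsuppTensorFinsupp ℂ ℂ B C M N (f ⊗ₜ[ℂ] g)) =
      (Finsupp.linearCombination B id f ⊗ₜ[ℂ] Finsupp.linearCombination C id g : M ⊗[ℂ] N) := by
    intro f g
    induction f using Finsupp.induction_linear with
    | zero => simp; rfl
    | add f₁ f₂ h₁ h₂ =>
      rw [TensorProduct.add_tmul, map_add, map_add, h₁, h₂, map_add, TensorProduct.add_tmul]
      rfl
    | single i b =>
      induction g using Finsupp.induction_linear with
      | zero => simp; rfl
      | add g₁ g₂ h₁ h₂ =>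
        rw [TensorProduct.tmul_add, map_add, map_add, h₁, h₂, map_add, TensorProduct.tmul_add]
        rfl
      | single l c =>
        rw [finsuppTensorFinsupp_single]
        rw [Finsupp.linearCombination_single, Finsupp.linearCombination_single]
        exact (Finsupp.linearCombination_single _ _ _).trans (ext_smul_tmul M N b c i l)
  refine Module.Projective.of_split k j (LinearMap.ext fun x => ?_)
  have hadd : ∀ x y : M ⊗[ℂ] N, j (k₀ (x + y)) = j (k₀ x) + j (k₀ y) := fun x y => by
    rw [map_add, map_add]
  change j (k₀ x) = x
  induction x using TensorProduct.induction_on with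
  | zero => rw [map_zero, map_zero]; rfl
  | add x y hx hy => rw [hadd, hx, hy]; rfl
  | tmul m n =>
    have h0 : k₀ (m ⊗ₜ[ℂ] n) = finsuppTensorFinsupp ℂ ℂ B C M N (s m ⊗ₜ[ℂ] t n) := rfl
    rw [h0, hj, hs, ht]

/-- The external tensor product `f ⊗ g` of linear maps. -/
def extMap {L M : FGMod B} {X Y : FGMod C} (f : L →ₗ[B] M) (g : X →ₗ[C] Y) :
    L.ext X →ₗ[B ⊗[ℂ] C] M.ext Y where
  toFun := TensorProduct.map (f.restrictScalars ℂ) (g.restrictScalars ℂ)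
  map_add' := map_add (TensorProduct.map (f.restrictScalars ℂ) (g.restrictScalars ℂ))
  map_smul' := by
    intro a x
    let F : (L.ext X : Type u) →+ (M.ext Y : Type u) :=
      (TensorProduct.map (f.restrictScalars ℂ) (g.restrictScalars ℂ)).toAddMonoidHom
    change F (a • x) = a • F x
    induction a using TensorProduct.induction_on with
    | zero => rw [zero_smul, zero_smul, map_zero]
    | add a b ha hb => rw [add_smul, add_smul, map_add, ha, hb]
    | tmul b c =>
      induction x using TensorProduct.induction_on with
      | zero =>
        change F ((b ⊗ₜ[ℂ] c) • (0 : L.ext X)) = (b ⊗ₜ[ℂ] c) • F (0 : L.ext X)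
        rw [smul_zero, map_zero, smul_zero]
      | add x y hx hy =>
        let x' : L.ext X := x
        let y' : L.ext X := y
        change F ((b ⊗ₜ[ℂ] c) • (x' + y')) = (b ⊗ₜ[ℂ] c) • F (x' + y')
        rw [smul_add, map_add, map_add, smul_add]
        exact congrArg₂ (· + ·) hx hy
      | tmul m n =>
        change (f (b • m)) ⊗ₜ[ℂ] (g (c • n)) = (b • f m) ⊗ₜ[ℂ] (c • g n)
        rw [map_smul, map_smul]

theorem ext_exact_left {L M N : FGMod B} (X : FGMod C) (f : L →ₗ[B] M) (g : M →ₗ[B] N)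
    (h : IsShortExact f g) :
    IsShortExact (extMap f (LinearMap.id : X →ₗ[C] X)) (extMap g (LinearMap.id : X →ₗ[C] X)) where
  injective := Module.Flat.rTensor_preserves_injective_linearMap (M := X)
    (f.restrictScalars ℂ) h.injective
  exact := rTensor_exact X (f := f.restrictScalars ℂ) (g := g.restrictScalars ℂ)
    h.exact h.surjective
  surjective := LinearMap.rTensor_surjective X (g := g.restrictScalars ℂ) h.surjective

theorem ext_exact_right {L M N : FGMod C} (X : FGMod B) (f : L →ₗ[C] M) (g : M →ₗ[C] N)
    (h : IsShortExact f g) :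
    IsShortExact (extMap (LinearMap.id : X →ₗ[B] X) f) (extMap (LinearMap.id : X →ₗ[B] X) g) where
  injective := Module.Flat.lTensor_preserves_injective_linearMap (M := X)
    (f.restrictScalars ℂ) h.injective
  exact := lTensor_exact X (f := f.restrictScalars ℂ) (g := g.restrictScalars ℂ)
    h.exact h.surjective
  surjective := LinearMap.lTensor_surjective X (g := g.restrictScalars ℂ) h.surjective

/-- The map `[M] ⊗ [N] ↦ [M ⊗ N]` on Grothendieck groups of classes of modules that are
compatible with external tensor products. -/
def Groth.ext {P : FGMod B → Prop} {Q : FGMod C → Prop} {R : FGMod (B ⊗[ℂ] C) → Prop}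
    (hR : ∀ M N, P M → Q N → R (M.ext N)) : Groth P ⊗[ℤ] Groth Q →+ Groth R :=
  TensorProduct.liftAddHom
    (Groth.lift (fun M hM => Groth.lift (fun N hN => Groth.cls (M.ext N) (hR M N hM hN))
        fun _ _ _ _ _ _ f g h => Groth.cls_exact _ _ _ _ _ (ext_exact_right M f g h))
      fun _ _ _ _ _ _ f g h => Groth.hom_ext fun X hX => by
        rw [AddMonoidHom.add_apply, Groth.lift_cls, Groth.lift_cls, Groth.lift_cls]
        exact Groth.cls_exact _ _ _ _ _ (ext_exact_left X f g h))
    fun r m n => by rw [map_zsmul, map_zsmul, AddMonoidHom.zsmul_apply]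

@[simp]
theorem Groth.ext_cls {P : FGMod B → Prop} {Q : FGMod C → Prop} {R : FGMod (B ⊗[ℂ] C) → Prop}
    (hR : ∀ M N, P M → Q N → R (M.ext N)) (M N) (hM : P M) (hN : Q N) :
    Groth.ext hR (Groth.cls M hM ⊗ₜ[ℤ] Groth.cls N hN) = Groth.cls (M.ext N) (hR M N hM hN) := by
  rw [Groth.ext, TensorProduct.liftAddHom_tmul, Groth.lift_cls, Groth.lift_cls]

end External

/-! ### Restriction and induction along an algebra homomorphism -/

section IndRes

variable {A B : Type u} [Ring A] [Algebra ℂ A] [Ring B] [Algebra ℂ B] (φ : B →ₐ[ℂ] A)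

/-- `A` is projective as a left `B`-module, for the action `b • a = φ b * a`. -/
def LeftProjective : Prop :=
  letI : Module B A := Module.compHom A φ.toRingHom
  Module.Projective B A

/-- `A` is projective as a right `B`-module, for the action `a • b = a * φ b`. -/
def RightProjective : Prop :=
  letI : Module Bᵐᵒᵖ A := Module.compHom A φ.toRingHom.op
  Module.Projective Bᵐᵒᵖ A

section Res

variable [Module.Finite ℂ A]

/-- The restriction of an `A`-module along `φ`: the same space, with `b • m = φ b • m`. -/
def FGMod.res (M : FGMod A) : FGMod B :=
  letI : Module B M := Module.compHom M φ.toRingHom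
  haveI : IsScalarTower ℂ B M := ⟨fun z b m => by
    change φ (z • b) • m = z • (φ b • m)
    rw [map_smul, smul_assoc]⟩
  { carrier := M
    fg := Module.Finite.of_restrictScalars_finite ℂ B M }

theorem res_projective (hφ : LeftProjective φ) (M : FGMod A) (hM : projMod M) :
    projMod (M.res φ) := by
  classical
  let _ : Module B A := Module.compHom A φ.toRingHom
  have : Module.Projective B A := hφ
  have : Module.Projective B (M →₀ A) := .of_equiv' (finsuppLequivDFinsupp B).symm
  obtain ⟨s, hs⟩ := hM.out
  let k : M.res φ →ₗ[B] (M →₀ A) :=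
    { toFun := s
      map_add' := map_add s
      map_smul' := fun b m => by
        refine (LinearMap.map_smul s (φ b) m).trans ?_
        ext i
        rfl }
  let j : (M →₀ A) →ₗ[B] M.res φ :=
    { toFun := Finsupp.linearCombination A id
      map_add' := map_add (Finsupp.linearCombination A id)
      map_smul' := fun b f => by
        refine Eq.trans (congrArg _ ?_) (map_smul (Finsupp.linearCombination A id) (φ b) f)
        ext i
        rfl }
  exact Module.Projective.of_split k j (LinearMap.ext hs)

/-- Restriction on Grothendieck groups. -/
def Groth.res {P : FGMod A → Prop} {Q : FGMod B → Prop} (hQ : ∀ M, P M → Q (M.res φ)) :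
    Groth P →+ Groth Q :=
  Groth.lift (fun M hM => Groth.cls (M.res φ) (hQ M hM)) fun L M N _ _ _ f g h =>
    Groth.cls_exact _ _ _
      ({ toFun := f, map_add' := map_add f, map_smul' := fun b m => LinearMap.map_smul f (φ b) m } :
        L.res φ →ₗ[B] M.res φ)
      ({ toFun := g, map_add' := map_add g, map_smul' := fun b m => LinearMap.map_smul g (φ b) m } :
        M.res φ →ₗ[B] N.res φ)
      ⟨h.injective, h.exact, h.surjective⟩

@[simp]
theorem Groth.res_cls {P : FGMod A → Prop} {Q : FGMod B → Prop} (hQ : ∀ M, P M → Q (M.res φ))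
    (M) (hM : P M) : Groth.res φ hQ (Groth.cls M hM) = Groth.cls (M.res φ) (hQ M hM) :=
  Groth.lift_cls _ _ _ _

end Res

section Ind

/-- The relations `a φ(b) ⊗ n = a ⊗ b n` in `A ⊗ N`. -/
def indRel (N : FGMod B) : Submodule A (A ⊗[ℂ] N) :=
  Submodule.span A {t | ∃ (a : A) (b : B) (n : N), t = (a * φ b) ⊗ₜ[ℂ] n - a ⊗ₜ[ℂ] (b • n)}

theorem ind_mk_rel (N : FGMod B) (a : A) (b : B) (n : N) :
    (Submodule.Quotient.mk ((a * φ b) ⊗ₜ[ℂ] n) : (A ⊗[ℂ] N) ⧸ indRel φ N) =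
      Submodule.Quotient.mk (a ⊗ₜ[ℂ] (b • n)) :=
  (Submodule.Quotient.eq _).2 (Submodule.subset_span ⟨a, b, n, rfl⟩)

variable [Module.Finite ℂ A] [Module.Finite ℂ B]

/-- The induced module `A ⊗_φ N`: the quotient of `A ⊗ N` by the relations
`a φ(b) ⊗ n = a ⊗ b n`. -/
def FGMod.ind (N : FGMod B) : FGMod A where
  carrier := (A ⊗[ℂ] N) ⧸ indRel φ N
  fg := Module.Finite.of_restrictScalars_finite ℂ _ _

/-- The map of induced modules coming from a map of modules. -/
def indMap {L M : FGMod B} (f : L →ₗ[B] M) : L.ind φ →ₗ[A] M.ind φ :=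
  Submodule.mapQ (indRel φ L) (indRel φ M)
    (TensorProduct.AlgebraTensorModule.map LinearMap.id (f.restrictScalars ℂ)) <| by
      rw [indRel, Submodule.span_le]
      rintro _ ⟨a, b, n, rfl⟩
      refine Submodule.subset_span ⟨a, b, f n, ?_⟩
      simp

theorem indMap_mk {L M : FGMod B} (f : L →ₗ[B] M) (x : A ⊗[ℂ] L) :
    indMap φ f (Submodule.Quotient.mk x) =
      Submodule.Quotient.mk ((f.restrictScalars ℂ).lTensor A x) := rfl

/-- The map `A ⊗_φ N → X`, `a ⊗ n ↦ a g(n)`, for a `B`-linear map `g : N → X`. -/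
def indLift {N : FGMod B} {X : Type u} [AddCommGroup X] [Module ℂ X] [Module A X]
    [IsScalarTower ℂ A X] (g : N →ₗ[ℂ] X) (hg : ∀ (b : B) (n : N), g (b • n) = φ b • g n) :
    N.ind φ →ₗ[A] X :=
  Submodule.liftQ (indRel φ N) (TensorProduct.AlgebraTensorModule.lift
    (LinearMap.toSpanSingleton A (N →ₗ[ℂ] X) g)) <| by
      rw [indRel, Submodule.span_le]
      rintro _ ⟨a, b, n, rfl⟩
      simp [hg, mul_smul]

theorem ind_projective (N : FGMod B) (hN : projMod N) : projMod (N.ind φ) := by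
  obtain ⟨s, hs⟩ := hN.out
  let g : N →ₗ[ℂ] (N →₀ A) := Finsupp.mapRange.linearMap φ.toLinearMap ∘ₗ s.restrictScalars ℂ
  have hg : ∀ (b : B) (n : N), g (b • n) = φ b • g n := fun b n => by
    ext i
    simp [g]
  let j : (N →₀ A) →ₗ[A] ((A ⊗[ℂ] N) ⧸ indRel φ N) :=
    Finsupp.linearCombination A fun n => (indRel φ N).mkQ (1 ⊗ₜ[ℂ] n)
  have hj : ∀ (a : A) (f : N →₀ B), j (a • Finsupp.mapRange.linearMap φ.toLinearMap f) =
      (indRel φ N).mkQ (a ⊗ₜ[ℂ] Finsupp.linearCombination B id f) := by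
    intro a f
    induction f using Finsupp.induction_linear with
    | zero => simp
    | add f₁ f₂ h₁ h₂ => simp only [map_add, smul_add, h₁, h₂, TensorProduct.tmul_add]
    | single n b =>
      simp only [Finsupp.mapRange.linearMap_apply, Finsupp.mapRange_single, Finsupp.smul_single,
        j, Finsupp.linearCombination_single, id, ← map_smul, TensorProduct.smul_tmul']
      simpa using ind_mk_rel φ N a b n
  refine Module.Projective.of_split (indLift φ g hg) j (LinearMap.ext fun x => ?_)
  obtain ⟨x, rfl⟩ := (indRel φ N).mkQ_surjective x
  change j (TensorProduct.AlgebraTensorModule.lift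
    (LinearMap.toSpanSingleton A (N →ₗ[ℂ] (N →₀ A)) g) x) = (indRel φ N).mkQ x
  induction x using TensorProduct.induction_on with
  | zero => simp
  | add x y hx hy => rw [map_add, map_add, map_add, hx, hy]
  | tmul a n =>
    refine (hj a (s n)).trans ?_
    rw [hs]

theorem indMap_injective (hφ : RightProjective φ) {L M : FGMod B} (f : L →ₗ[B] M)
    (hf : Function.Injective f) : Function.Injective (indMap φ f) := by
  let _ : Module Bᵐᵒᵖ A := Module.compHom A φ.toRingHom.op
  have : Module.Projective Bᵐᵒᵖ A := hφ
  obtain ⟨s, hs⟩ := Module.Projective.out (R := Bᵐᵒᵖ) (P := A)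
  have hsb : ∀ (a : A) (b : B) (i : A), (s (a * φ b) i).unop = (s a i).unop * b := by
    intro a b i
    have : s (a * φ b) = MulOpposite.op b • s a := s.map_smul (MulOpposite.op b) a
    rw [this]
    rfl
  let θ₀ (N : FGMod B) : A ⊗[ℂ] N →+ (A →₀ N) := TensorProduct.liftAddHom
    (AddMonoidHom.mk' (fun a => AddMonoidHom.mk'
      (fun n => (s a).mapRange (fun c => c.unop • n) (by simp)) fun x y => by ext; simp)
      fun x y => by ext; simp [add_smul])
    fun z a n => by
      have h : z • a = a * φ (algebraMap ℂ B z) := by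
        rw [AlgHom.commutes, ← Algebra.commutes, Algebra.smul_def]
      ext i
      change (s (z • a) i).unop • n = (s a i).unop • (z • n)
      rw [h, hsb, mul_smul, algebraMap_smul]
  have hθ₀ (N : FGMod B) (a : A) (n : N) (i : A) : θ₀ N (a ⊗ₜ[ℂ] n) i = (s a i).unop • n := rfl
  have hrel (N : FGMod B) : ∀ x ∈ indRel φ N, θ₀ N x = 0 := by
    intro x hx
    suffices h : ∀ a : A, θ₀ N (a • x) = 0 by simpa using h 1
    induction hx using Submodule.span_induction with
    | mem x hx =>
      obtain ⟨a, b, n, rfl⟩ := hx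
      intro a'
      ext i
      rw [smul_sub, map_sub, TensorProduct.smul_tmul', TensorProduct.smul_tmul', Finsupp.sub_apply,
        hθ₀, hθ₀, smul_eq_mul, smul_eq_mul, ← mul_assoc, hsb, mul_smul, sub_self]
      rfl
    | zero => simp
    | add x y _ _ hx hy => intro a; rw [smul_add, map_add, hx, hy, add_zero]
    | smul c x _ hx => intro a; rw [smul_smul, hx]
  let η (N : FGMod B) : (A →₀ N) →+ ((A ⊗[ℂ] N) ⧸ indRel φ N) :=
    Finsupp.liftAddHom fun i => (AddMonoidHom.mk' (fun n : N => (indRel φ N).mkQ (i ⊗ₜ[ℂ] n))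
      fun x y => by rw [TensorProduct.tmul_add, map_add])
  have hη (N : FGMod B) (x : A ⊗[ℂ] N) : η N (θ₀ N x) = (indRel φ N).mkQ x := by
    induction x using TensorProduct.induction_on with
    | zero => simp
    | add x y hx hy => rw [map_add, map_add, map_add, hx, hy]
    | tmul a n =>
      have key : ∀ c : A →₀ Bᵐᵒᵖ, η N (c.mapRange (fun c => c.unop • n) (by simp)) =
          (indRel φ N).mkQ (Finsupp.linearCombination Bᵐᵒᵖ id c ⊗ₜ[ℂ] n) := by
        intro c
        induction c using Finsupp.induction_linear with
        | zero => simp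
        | add c₁ c₂ h₁ h₂ =>
          rw [map_add, TensorProduct.add_tmul, map_add, ← h₁, ← h₂, ← map_add]
          congr 1
          ext i
          simp [add_smul]
        | single i b =>
          rw [Finsupp.mapRange_single, Finsupp.linearCombination_single]
          refine (Finsupp.liftAddHom_apply_single _ _ _).trans ?_
          exact (ind_mk_rel φ N i b.unop n).symm
      refine (key (s a)).trans ?_
      rw [hs]
  rw [injective_iff_map_eq_zero]
  intro x hx
  obtain ⟨x, rfl⟩ := (indRel φ L).mkQ_surjective x
  have h1 : (f.restrictScalars ℂ).lTensor A x ∈ indRel φ M :=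
    (Submodule.Quotient.mk_eq_zero _).1 hx
  have nat : ∀ x : A ⊗[ℂ] L, ∀ i, θ₀ M ((f.restrictScalars ℂ).lTensor A x) i = f (θ₀ L x i) := by
    intro x i
    induction x using TensorProduct.induction_on with
    | zero => simp
    | add x y hx hy => rw [map_add, map_add, map_add, Finsupp.add_apply, Finsupp.add_apply,
        map_add, hx, hy]
    | tmul a n =>
      rw [LinearMap.lTensor_tmul, hθ₀, hθ₀, map_smul]
      rfl
  have h2 : θ₀ L x = 0 := by
    ext i
    apply hf
    rw [← nat, hrel M _ h1]
    simp
  rw [← hη, h2, map_zero]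
  rfl

theorem ind_exact (hφ : RightProjective φ) {L M N : FGMod B} (f : L →ₗ[B] M) (g : M →ₗ[B] N)
    (h : IsShortExact f g) : IsShortExact (indMap φ f) (indMap φ g) where
  injective := indMap_injective φ hφ f h.injective
  exact := by
    have hex := lTensor_exact A (f := f.restrictScalars ℂ) (g := g.restrictScalars ℂ)
      h.exact h.surjective
    intro x
    obtain ⟨x, rfl⟩ := (indRel φ M).mkQ_surjective x
    constructor
    · intro hx
      have h1 : (g.restrictScalars ℂ).lTensor A x ∈ indRel φ N :=
        (Submodule.Quotient.mk_eq_zero _).1 hx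
      have h2 : indRel φ N ≤ (indRel φ M).map
          (TensorProduct.AlgebraTensorModule.map LinearMap.id (g.restrictScalars ℂ)) := by
        rw [indRel, Submodule.span_le]
        rintro _ ⟨a, b, n, rfl⟩
        obtain ⟨m, rfl⟩ := h.surjective n
        exact ⟨_, Submodule.subset_span ⟨a, b, m, rfl⟩, by simp⟩
      obtain ⟨y, hy, hyx⟩ := h2 h1
      have h3 : (g.restrictScalars ℂ).lTensor A (x - y) = 0 := by
        rw [map_sub, sub_eq_zero]
        exact hyx.symm
      obtain ⟨z, hz⟩ := (hex _).1 h3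
      refine ⟨(indRel φ L).mkQ z, ?_⟩
      refine (congrArg (indRel φ M).mkQ hz).trans ?_
      rw [map_sub, sub_eq_self]
      exact (Submodule.Quotient.mk_eq_zero _).2 hy
    · rintro ⟨y, hy⟩
      obtain ⟨y, rfl⟩ := (indRel φ L).mkQ_surjective y
      rw [← hy]
      refine (congrArg (indRel φ N).mkQ ((hex _).2 ⟨y, rfl⟩)).trans (map_zero _)
  surjective := by
    intro x
    obtain ⟨x, rfl⟩ := (indRel φ N).mkQ_surjective x
    obtain ⟨y, rfl⟩ := LinearMap.lTensor_surjective A (g := g.restrictScalars ℂ) h.surjective x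
    exact ⟨(indRel φ M).mkQ y, rfl⟩

/-- Induction on Grothendieck groups. -/
def Groth.ind (hφ : RightProjective φ) {P : FGMod B → Prop} {Q : FGMod A → Prop}
    (hQ : ∀ N, P N → Q (N.ind φ)) : Groth P →+ Groth Q :=
  Groth.lift (fun N hN => Groth.cls (N.ind φ) (hQ N hN)) fun _ _ _ _ _ _ f g h =>
    Groth.cls_exact _ _ _ _ _ (ind_exact φ hφ f g h)

@[simp]
theorem Groth.ind_cls (hφ : RightProjective φ) {P : FGMod B → Prop} {Q : FGMod A → Prop}
    (hQ : ∀ N, P N → Q (N.ind φ)) (N) (hN : P N) :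
    Groth.ind φ hφ hQ (Groth.cls N hN) = Groth.cls (N.ind φ) (hQ N hN) :=
  Groth.lift_cls _ _ _ _

end Ind

end IndRes

/-! ### The pairing of `K₀(B)` and `G₀(B)` -/

section Pairing

variable {B : Type u} [Ring B] [Algebra ℂ B]

theorem finrank_of_exact {X Y Z : Type*} [AddCommGroup X] [Module ℂ X] [AddCommGroup Y]
    [Module ℂ Y] [AddCommGroup Z] [Module ℂ Z] [Module.Finite ℂ Y] (f : X →ₗ[ℂ] Y) (g : Y →ₗ[ℂ] Z)
    (hf : Function.Injective f) (hex : Function.Exact f g) (hg : Function.Surjective g) :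
    (Module.finrank ℂ Y : ℤ) = Module.finrank ℂ X + Module.finrank ℂ Z := by
  have h1 := g.finrank_range_add_finrank_ker
  rw [LinearMap.range_eq_top.2 hg, finrank_top, LinearMap.exact_iff.1 hex,
    LinearMap.finrank_range_of_inj hf] at h1
  rw [← h1]
  push_cast
  ring

variable [Module.Finite ℂ B]

instance (P M : FGMod B) : Module.Finite ℂ (P →ₗ[B] M) :=
  Module.Finite.of_injective (LinearMap.restrictScalarsₗ ℂ B P M ℂ)
    (LinearMap.restrictScalars_injective ℂ)

/-- The dimension of `Hom_B(P, M)`. -/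
def homDim (P M : FGMod B) : ℤ := Module.finrank ℂ (P →ₗ[B] M)

theorem homDim_exact_right (P : FGMod B) (hP : projMod P) {L M N : FGMod B} (f : L →ₗ[B] M)
    (g : M →ₗ[B] N) (h : IsShortExact f g) : homDim P M = homDim P L + homDim P N := by
  have : Module.Projective B P := hP
  let F : (P →ₗ[B] L) →ₗ[ℂ] (P →ₗ[B] M) :=
    { toFun k := f ∘ₗ k, map_add' _ _ := by ext; simp, map_smul' z k := by
        ext x
        exact LinearMap.map_smul_of_tower f z (k x) }
  let G : (P →ₗ[B] M) →ₗ[ℂ] (P →ₗ[B] N) :=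
    { toFun k := g ∘ₗ k, map_add' _ _ := by ext; simp, map_smul' z k := by
        ext x
        exact LinearMap.map_smul_of_tower g z (k x) }
  refine finrank_of_exact F G ?_ ?_ ?_
  · intro k₁ k₂ hk
    ext x
    exact h.injective (LinearMap.congr_fun hk x)
  · intro k
    constructor
    · intro hk
      obtain ⟨l, hl⟩ := Module.projective_lifting_property (f.rangeRestrict)
        (k.codRestrict (LinearMap.range f) fun x => (h.exact _).1 (LinearMap.congr_fun hk x))
        f.surjective_rangeRestrict
      refine ⟨l, ?_⟩
      ext x
      exact congrArg Subtype.val (LinearMap.congr_fun hl x)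
    · rintro ⟨l, rfl⟩
      ext x
      exact (h.exact _).2 ⟨l x, rfl⟩
  · intro k
    obtain ⟨l, hl⟩ := Module.projective_lifting_property g k h.surjective
    exact ⟨l, hl⟩

theorem homDim_exact_left (X : FGMod B) {L M N : FGMod B} (hN : projMod N) (f : L →ₗ[B] M)
    (g : M →ₗ[B] N) (h : IsShortExact f g) : homDim M X = homDim L X + homDim N X := by
  have : Module.Projective B N := hN
  let F : (N →ₗ[B] X) →ₗ[ℂ] (M →ₗ[B] X) :=
    { toFun k := k ∘ₗ g, map_add' _ _ := by ext; simp, map_smul' z k := by ext x; simp }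
  let G : (M →ₗ[B] X) →ₗ[ℂ] (L →ₗ[B] X) :=
    { toFun k := k ∘ₗ f, map_add' _ _ := by ext; simp, map_smul' z k := by ext x; simp }
  obtain ⟨s, hs⟩ := Module.projective_lifting_property g LinearMap.id h.surjective
  have hs' : ∀ y, g (s y) = y := LinearMap.congr_fun hs
  rw [add_comm]
  refine finrank_of_exact F G ?_ ?_ ?_
  · intro k₁ k₂ hk
    ext x
    obtain ⟨x, rfl⟩ := h.surjective x
    exact LinearMap.congr_fun hk x
  · intro k
    constructor
    · intro hk
      refine ⟨k ∘ₗ s, ?_⟩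
      ext x
      change k (s (g x)) = k x
      obtain ⟨y, hy⟩ := (h.exact (s (g x) - x)).1 (by rw [map_sub, hs', sub_self])
      have h0 : k (f y) = 0 := LinearMap.congr_fun hk y
      rwa [hy, map_sub, sub_eq_zero] at h0
    · rintro ⟨l, rfl⟩
      ext x
      change l (g (f x)) = 0
      rw [(h.exact _).2 ⟨x, rfl⟩, map_zero]
  · intro k
    let e : L ≃ₗ[B] LinearMap.range f := LinearEquiv.ofInjective f h.injective
    let p : M →ₗ[B] LinearMap.range f := (LinearMap.id - s ∘ₗ g).codRestrict _ fun x =>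
      (h.exact _).1 (by simp [hs'])
    refine ⟨k ∘ₗ e.symm.toLinearMap ∘ₗ p, ?_⟩
    ext x
    change k (e.symm (p (f x))) = k x
    congr 1
    rw [LinearEquiv.symm_apply_eq]
    ext
    change f x - s (g (f x)) = f x
    rw [(h.exact _).2 ⟨x, rfl⟩, map_zero, sub_zero]

variable (B) in
/-- The pairing `K₀(B) × G₀(B) → ℤ`, `⟨[P], [M]⟩ = dim Hom_B(P, M)`. -/
def pairing₀ : K0 B →+ G0 B →+ ℤ :=
  Groth.lift (fun P hP => Groth.lift (fun M _ => homDim P M)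
      fun _ _ _ _ _ _ f g h => homDim_exact_right P hP f g h)
    fun _ _ _ _ _ hN f g h => Groth.hom_ext fun X hX => by
      rw [AddMonoidHom.add_apply, Groth.lift_cls, Groth.lift_cls, Groth.lift_cls]
      exact homDim_exact_left X hN f g h

@[simp]
theorem pairing₀_cls (P M : FGMod B) (hP : projMod P) (hM : allMod M) :
    pairing₀ B (Groth.cls P hP) (Groth.cls M hM) = homDim P M := by
  rw [pairing₀, Groth.lift_cls, Groth.lift_cls]

end Pairing

/-! ### Graded Hopf algebras and Hopf pairings -/

section Hopf

/-- Let `X n` be the Grothendieck groups of the levels `A n` of a tower, `Y k l` those of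
`A k ⊗ A l`, with the external tensor product `ext`, induction `ind` and restriction `res`.
The Hopf algebra `H`, identified with `⨁ n, X n` by `e`, has the multiplication given by induction,
`[M] [N] = [Ind (M ⊗ N)]`, and the comultiplication given by restriction,
`Δ [N] = ∑_{k + l = n} [Res_{k,l} N]`.  The latter is expressed on the components of `Δ [N]` in
`X k ⊗ X l`, for all `k` and `l`, where `X k ⊗ X l` is compared with `Y k l` through `ext`. -/
structure IsIndResHopf {X : ℕ → Type v} {Y : ℕ → ℕ → Type v} [∀ n, AddCommGroup (X n)]
    [∀ k l, AddCommGroup (Y k l)] (ext : ∀ k l, X k ⊗[ℤ] X l →+ Y k l)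
    (ind : ∀ k l, Y k l →+ X (k + l)) (res : ∀ k l, X (k + l) →+ Y k l)
    {H : Type v} [Semiring H] [HopfAlgebra ℤ H] (e : (⨁ n, X n) ≃ₗ[ℤ] H) : Prop where
  mul : ∀ k l (x : X k) (y : X l),
    e (DirectSum.of X k x) * e (DirectSum.of X l y) =
      e (DirectSum.of X (k + l) (ind k l (ext k l (x ⊗ₜ[ℤ] y))))
  comul : ∀ k l (x : X (k + l)),
    ext k l (TensorProduct.map (DirectSum.component ℤ ℕ X k ∘ₗ e.symm.toLinearMap)
      (DirectSum.component ℤ ℕ X l ∘ₗ e.symm.toLinearMap)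
      (Coalgebra.comul (R := ℤ) (e (DirectSum.of X (k + l) x)))) = res k l x
  comul_of_ne : ∀ n k l (x : X n), k + l ≠ n →
    TensorProduct.map (DirectSum.component ℤ ℕ X k ∘ₗ e.symm.toLinearMap)
      (DirectSum.component ℤ ℕ X l ∘ₗ e.symm.toLinearMap)
      (Coalgebra.comul (R := ℤ) (e (DirectSum.of X n x))) = 0

/-- The pairing of `H ⊗ H` and `H' ⊗ H'` induced by a pairing of `H` and `H'`,
`⟨p ⊗ q, x ⊗ y⟩ = ⟨p, x⟩ ⟨q, y⟩`. -/
def tensorPairing {H H' : Type v} [AddCommMonoid H] [Module ℤ H] [AddCommMonoid H'] [Module ℤ H']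
    (π : H →ₗ[ℤ] H' →ₗ[ℤ] ℤ) : H ⊗[ℤ] H →ₗ[ℤ] H' ⊗[ℤ] H' →ₗ[ℤ] ℤ :=
  TensorProduct.dualDistrib ℤ H' H' ∘ₗ TensorProduct.map π π

/-- Under the pairing `π`, the multiplication and unit of each of the two bialgebras are dual to the
comultiplication and counit of the other. -/
structure IsHopfPairing {H H' : Type v} [Semiring H] [Bialgebra ℤ H] [Semiring H'] [Bialgebra ℤ H']
    (π : H →ₗ[ℤ] H' →ₗ[ℤ] ℤ) : Prop where
  mul_left : ∀ p q x, π (p * q) x = tensorPairing π (p ⊗ₜ[ℤ] q) (Coalgebra.comul x)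
  mul_right : ∀ p x y, π p (x * y) = tensorPairing π (Coalgebra.comul p) (x ⊗ₜ[ℤ] y)
  one_left : ∀ x, π 1 x = Coalgebra.counit x
  one_right : ∀ p, π p 1 = Coalgebra.counit p

end Hopf

/-! ### Towers of algebras -/

/-- A tower of algebras: a graded `ℂ`-algebra `⨁ n, A n` with (external) multiplication `ρ`, such
that each `A n` is itself a finite-dimensional `ℂ`-algebra, `A 0 ≅ ℂ`, the maps
`ρ m n : A m ⊗ A n → A (m + n)` are injective unital algebra homomorphisms, and `A (m + n)` is
projective as a left and as a right module over `A m ⊗ A n`. -/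
structure Tower (A : ℕ → Type u) [∀ n, Ring (A n)] [∀ n, Algebra ℂ (A n)]
    [∀ n, Module.Finite ℂ (A n)] where
  ρ : ∀ m n, A m ⊗[ℂ] A n →ₐ[ℂ] A (m + n)
  one_mul : ∀ n (a : A n), HEq (ρ 0 n (1 ⊗ₜ[ℂ] a)) a
  mul_one : ∀ n (a : A n), HEq (ρ n 0 (a ⊗ₜ[ℂ] 1)) a
  mul_assoc : ∀ l m n (a : A l) (b : A m) (c : A n),
    HEq (ρ (l + m) n (ρ l m (a ⊗ₜ[ℂ] b) ⊗ₜ[ℂ] c)) (ρ l (m + n) (a ⊗ₜ[ℂ] ρ m n (b ⊗ₜ[ℂ] c)))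
  zero_equiv : Nonempty (A 0 ≃ₐ[ℂ] ℂ)
  injective : ∀ m n, Function.Injective (ρ m n)
  leftProjective : ∀ m n, LeftProjective (ρ m n)
  rightProjective : ∀ m n, RightProjective (ρ m n)

namespace Tower

variable {A : ℕ → Type u} [∀ n, Ring (A n)] [∀ n, Algebra ℂ (A n)] [∀ n, Module.Finite ℂ (A n)]

variable (A) in
/-- `G(A) = ⨁ n, G₀(A n)`. -/
abbrev G : Type (u + 1) := ⨁ n, G0 (A n)

variable (A) in
/-- `K(A) = ⨁ n, K₀(A n)`. -/
abbrev K : Type (u + 1) := ⨁ n, K0 (A n)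

variable (A) in
/-- The pairing `K(A) × G(A) → ℤ`: `⟨[P], [M]⟩ = dim Hom(P, M)` if `P` and `M` are modules over the
same `A n`, and `0` otherwise. -/
def pairing : K A →ₗ[ℤ] G A →ₗ[ℤ] ℤ :=
  DirectSum.toModule ℤ ℕ (G A →ₗ[ℤ] ℤ) fun n =>
    LinearMap.lcomp ℤ ℤ (DirectSum.component ℤ ℕ (fun n => G0 (A n)) n) ∘ₗ
      (addMonoidHomLequivInt ℤ).toLinearMap ∘ₗ (pairing₀ (A n)).toIntLinearMap

variable (A) in
/-- `[M] ⊗ [N] ↦ [M ⊗ N]` for finitely generated modules. -/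
def extG (k l : ℕ) : G0 (A k) ⊗[ℤ] G0 (A l) →+ G0 (A k ⊗[ℂ] A l) :=
  Groth.ext fun _ _ _ _ => trivial

variable (A) in
/-- `[P] ⊗ [Q] ↦ [P ⊗ Q]` for finitely generated projective modules. -/
def extK (k l : ℕ) : K0 (A k) ⊗[ℤ] K0 (A l) →+ K0 (A k ⊗[ℂ] A l) :=
  Groth.ext ext_projective

variable (T : Tower A)

/-- Induction from `A k ⊗ A l` to `A (k + l)`, on finitely generated modules. -/
def indG (k l : ℕ) : G0 (A k ⊗[ℂ] A l) →+ G0 (A (k + l)) :=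
  Groth.ind (T.ρ k l) (T.rightProjective k l) fun _ _ => trivial

/-- Induction from `A k ⊗ A l` to `A (k + l)`, on finitely generated projective modules. -/
def indK (k l : ℕ) : K0 (A k ⊗[ℂ] A l) →+ K0 (A (k + l)) :=
  Groth.ind (T.ρ k l) (T.rightProjective k l) (ind_projective (T.ρ k l))

/-- Restriction from `A (k + l)` to `A k ⊗ A l`, on finitely generated modules. -/
def resG (k l : ℕ) : G0 (A (k + l)) →+ G0 (A k ⊗[ℂ] A l) :=
  Groth.res (T.ρ k l) fun _ _ => trivial

/-- Restriction from `A (k + l)` to `A k ⊗ A l`, on finitely generated projective modules. -/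
def resK (k l : ℕ) : K0 (A (k + l)) →+ K0 (A k ⊗[ℂ] A l) :=
  Groth.res (T.ρ k l) (res_projective (T.ρ k l) (T.leftProjective k l))

/-- The Grothendieck groups `K(A)` and `G(A)` form a pair of graded dual Hopf algebras: with
induction as multiplication and restriction as comultiplication they are Hopf algebras, and these
are dual to each other under the pairing `⟨[P], [M]⟩ = dim Hom(P, M)`. -/
def FormsDualHopfPair : Prop :=
  ∃ (HK HG : Type (u + 1)) (_ : Semiring HK) (_ : Semiring HG) (_ : HopfAlgebra ℤ HK)
    (_ : HopfAlgebra ℤ HG) (eK : K A ≃ₗ[ℤ] HK) (eG : G A ≃ₗ[ℤ] HG),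
    IsIndResHopf (extK A) T.indK T.resK eK ∧
    IsIndResHopf (extG A) T.indG T.resG eG ∧
    IsHopfPairing ((pairing A).compl₁₂ eK.symm.toLinearMap eG.symm.toLinearMap)

end Tower

end AlgTower

end

/-! Everything is read off from the classes of the regular modules. Let `a` be the class of `A 1` in
`K(A)` and `b` its class in `G(A)`. Inducing the regular module of `A k ⊗ A l` gives the regular
module of `A (k + l)`, so for `n ≥ 1` the powers `a ^ n` and `b ^ n` are the classes of `A n`
(`Tower.indK_regular`, `Tower.indG_regular`, `pow_eq_of_mul`). Since `Hom(A n, A n)` is `A n`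
itself, `⟨a ^ n, b ^ n⟩ = dim A n`.

The same number can be computed from the Hopf structure. As `A 0 ≅ ℂ`, the degree-zero part of
`G(A)` is generated by one element (`G0.exists_zsmul_regular`). Hence `G(A)` is a connected graded
bialgebra and `b`, having degree one, is primitive (`comul_of_one`). Duality turns `⟨a * a ^ n, b ^
(n + 1)⟩` into the pairing of `a ⊗ a ^ n` with `(b ⊗ 1 + 1 ⊗ b) ^ (n + 1)`. By degree, only the
binomial term with a single `b` on the left survives, which contributes `(n + 1) ⟨a, b⟩ ⟨a ^ n, b ^
n⟩`. By induction `⟨a ^ n, b ^ n⟩ = n! ⟨a, b⟩ ^ n` (`IsHopfPairing.pow_pow`), and `⟨a, b⟩ = dim A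
1`. -/

namespace AlgTower

/-! ### Connected graded bialgebras over `ℤ` -/

section Graded

variable {X : ℕ → Type v} [∀ n, AddCommGroup (X n)] {H : Type v} [Semiring H]

theorem map_of_zsmul [Module ℤ H] (e : (⨁ n, X n) ≃ₗ[ℤ] H) (k : ℕ) (a : ℤ) (x : X k) :
    e (DirectSum.of X k (a • x)) = a • e (DirectSum.of X k x) :=
  (e.toLinearMap ∘ₗ DirectSum.lof ℤ ℕ X k).map_smul a x

/-- The grading is only assumed to be compatible with products, so the degree of the unit has to be
found. The degree-zero component of `1` acts as a left identity on homogeneous elements, hence on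
everything, and a left identity equals `1`. -/
theorem exists_one_eq_of_zero [Module ℤ H] (e : (⨁ n, X n) ≃ₗ[ℤ] H)
    (hmul : ∀ k l (x : X k) (y : X l), ∃ z : X (k + l),
      e (DirectSum.of X k x) * e (DirectSum.of X l y) = e (DirectSum.of X (k + l) z)) :
    ∃ x : X 0, (1 : H) = e (DirectSum.of X 0 x) := by
  -- For `x` of degree `n`, the part of `c` in degree `k` contributes to degree `k + n`, so the
  -- degree-`n` part of the product sees only `c 0`.
  have key : ∀ (c : ⨁ n, X n) n (x : X n), e.symm (e c * e (DirectSum.of X n x)) n =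
      e.symm (e (DirectSum.of X 0 (c 0)) * e (DirectSum.of X n x)) n := by
    intro c n x
    induction c using DirectSum.induction_on with
    | zero => simp
    | of k y =>
      rcases eq_or_ne k 0 with rfl | hk
      · rw [DirectSum.of_eq_same]
      · obtain ⟨z, hz⟩ := hmul k n y x
        rw [hz, DirectSum.of_eq_of_ne _ _ _ hk.symm, LinearEquiv.symm_apply_apply,
          DirectSum.of_eq_of_ne _ _ _ (by omega)]
        simp
    | add c d hc hd =>
      rw [DirectSum.add_apply, map_add, map_add, map_add, add_mul, add_mul, map_add, map_add,
        DirectSum.add_apply, DirectSum.add_apply, hc, hd]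
  refine ⟨e.symm 1 0, ?_⟩
  have hone : ∀ g : ⨁ n, X n, e (DirectSum.of X 0 (e.symm 1 0)) * e g = e g := by
    intro g
    induction g using DirectSum.induction_on with
    | zero => simp
    | of n x =>
      have h := key (e.symm 1) n x
      obtain ⟨z, hz⟩ := hmul 0 n (e.symm 1 0) x
      rw [hz, LinearEquiv.apply_symm_apply, one_mul, LinearEquiv.symm_apply_apply,
        LinearEquiv.symm_apply_apply] at h
      rw [hz]
      congr 1
      -- Here `z` lies in `X (0 + n)` and `x` in `X n`, so they are compared as elements of the
      -- direct sum, one component at a time.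
      ext j
      rcases eq_or_ne j n with rfl | hj
      · exact h.symm
      · rw [DirectSum.of_eq_of_ne _ _ _ hj, DirectSum.of_eq_of_ne _ _ _ (by omega)]
    | add c d hc hd => rw [map_add, mul_add, hc, hd]
  simpa using (hone (e.symm 1)).symm

/-- A submodule of `H ⊗ H` that has all bihomogeneous components of `z` contains `z`. -/
theorem mem_of_components [Module ℤ H] (e : (⨁ n, X n) ≃ₗ[ℤ] H) (P : Submodule ℤ (H ⊗[ℤ] H))
    (z : H ⊗[ℤ] H)
    (hz : ∀ k l, TensorProduct.map (e.toLinearMap ∘ₗ DirectSum.lof ℤ ℕ X k)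
      (e.toLinearMap ∘ₗ DirectSum.lof ℤ ℕ X l)
      (TensorProduct.map (DirectSum.component ℤ ℕ X k ∘ₗ e.symm.toLinearMap)
        (DirectSum.component ℤ ℕ X l ∘ₗ e.symm.toLinearMap) z) ∈ P) : z ∈ P := by
  -- An element of the tensor square is a finite sum of its bihomogeneous components. Asking for the
  -- equality for all `m ≥ N` lets the bounds of two summands be merged into their maximum.
  have hfin : ∃ N, ∀ m ≥ N, z = ∑ k ∈ Finset.range m, ∑ l ∈ Finset.range m,
      TensorProduct.map (e.toLinearMap ∘ₗ DirectSum.lof ℤ ℕ X k)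
      (e.toLinearMap ∘ₗ DirectSum.lof ℤ ℕ X l)
      (TensorProduct.map (DirectSum.component ℤ ℕ X k ∘ₗ e.symm.toLinearMap)
        (DirectSum.component ℤ ℕ X l ∘ₗ e.symm.toLinearMap) z) := by
    clear hz
    have hsum : ∀ c : ⨁ n, X n, ∃ N, ∀ m ≥ N,
        c = ∑ k ∈ Finset.range m, DirectSum.lof ℤ ℕ X k (c k) := by
      intro c
      induction c using DirectSum.induction_on with
      | zero => exact ⟨0, fun m _ => by simp⟩
      | of n x =>
        refine ⟨n + 1, fun m hm => ?_⟩
        rw [Finset.sum_eq_single n]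
        · rw [DirectSum.of_eq_same]; rfl
        · intro k _ hk
          rw [DirectSum.of_eq_of_ne _ _ _ hk, map_zero]
        · intro h
          exact absurd (Finset.mem_range.2 hm) h
      | add c d hc hd =>
        obtain ⟨N, hN⟩ := hc
        obtain ⟨N', hN'⟩ := hd
        refine ⟨max N N', fun m hm => ?_⟩
        simp only [DirectSum.add_apply, map_add, Finset.sum_add_distrib]
        rw [← hN m (le_trans (le_max_left _ _) hm), ← hN' m (le_trans (le_max_right _ _) hm)]
    induction z using TensorProduct.induction_on with
    | zero => exact ⟨0, fun m _ => by simp⟩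
    | tmul x y =>
      obtain ⟨N, hN⟩ := hsum (e.symm x)
      obtain ⟨N', hN'⟩ := hsum (e.symm y)
      refine ⟨max N N', fun m hm => ?_⟩
      have hx := congrArg e (hN m (le_trans (le_max_left _ _) hm))
      have hy := congrArg e (hN' m (le_trans (le_max_right _ _) hm))
      rw [LinearEquiv.apply_symm_apply, map_sum] at hx hy
      conv_lhs => rw [hx, hy, TensorProduct.sum_tmul]
      refine Finset.sum_congr rfl fun k _ => ?_
      rw [TensorProduct.tmul_sum]
      rfl
    | add z w hz hw =>
      obtain ⟨N, hN⟩ := hz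
      obtain ⟨N', hN'⟩ := hw
      refine ⟨max N N', fun m hm => ?_⟩
      simp only [map_add, Finset.sum_add_distrib]
      rw [← hN m (le_trans (le_max_left _ _) hm), ← hN' m (le_trans (le_max_right _ _) hm)]
  obtain ⟨N, hN⟩ := hfin
  rw [hN N le_rfl]
  exact P.sum_mem fun k _ => P.sum_mem fun l _ => hz k l

/-- This is connectedness. The unit is `m • s` for some integer `m`, and the counit sends it to `1`,
so `m` is invertible in `ℤ` with inverse the counit of `s`. Thus the unit generates degree zero as
well as `s` does. -/
theorem exists_eq_smul_one [Bialgebra ℤ H] (e : (⨁ n, X n) ≃ₗ[ℤ] H)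
    (hmul : ∀ k l (x : X k) (y : X l), ∃ z : X (k + l),
      e (DirectSum.of X k x) * e (DirectSum.of X l y) = e (DirectSum.of X (k + l) z))
    (s : X 0) (hs : ∀ x : X 0, ∃ a : ℤ, x = a • s) (x : X 0) :
    ∃ c : ℤ, e (DirectSum.of X 0 x) = c • (1 : H) := by
  obtain ⟨x₀, hx₀⟩ := exists_one_eq_of_zero e hmul
  obtain ⟨m, rfl⟩ := hs x₀
  obtain ⟨a, rfl⟩ := hs x
  rw [map_of_zsmul] at hx₀ ⊢
  have h1 := congrArg (Coalgebra.counit (R := ℤ)) hx₀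
  rw [Bialgebra.counit_one, map_smul, smul_eq_mul] at h1
  refine ⟨a * Coalgebra.counit (R := ℤ) (e (DirectSum.of X 0 s)), ?_⟩
  conv_rhs => rw [hx₀, smul_smul, mul_assoc, mul_comm _ m, ← h1, mul_one]

/-- In a connected graded bialgebra the elements of degree one are primitive. -/
theorem comul_of_one [Bialgebra ℤ H] (e : (⨁ n, X n) ≃ₗ[ℤ] H)
    (hmul : ∀ k l (x : X k) (y : X l), ∃ z : X (k + l),
      e (DirectSum.of X k x) * e (DirectSum.of X l y) = e (DirectSum.of X (k + l) z))
    (hcomul : ∀ n k l (x : X n), k + l ≠ n →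
      TensorProduct.map (DirectSum.component ℤ ℕ X k ∘ₗ e.symm.toLinearMap)
        (DirectSum.component ℤ ℕ X l ∘ₗ e.symm.toLinearMap)
        (Coalgebra.comul (R := ℤ) (e (DirectSum.of X n x))) = 0)
    (s : X 0) (hs : ∀ x : X 0, ∃ a : ℤ, x = a • s) (x : X 1) :
    Coalgebra.comul (R := ℤ) (e (DirectSum.of X 1 x)) =
      1 ⊗ₜ[ℤ] e (DirectSum.of X 1 x) + e (DirectSum.of X 1 x) ⊗ₜ[ℤ] 1 := by
  obtain ⟨x₀, hx₀⟩ := exists_one_eq_of_zero e hmul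
  have hsm := exists_eq_smul_one e hmul s hs
  -- `P` is `1 ⊗ X 1 + X 1 ⊗ 1`. Only the components of bidegree `(0, 1)` and `(1, 0)` of the
  -- coproduct can be nonzero, and they lie in `P` because degree zero consists of the multiples of
  -- `1`.
  let P : Submodule ℤ (H ⊗[ℤ] H) :=
    LinearMap.range (TensorProduct.mk ℤ H H 1 ∘ₗ e.toLinearMap ∘ₗ DirectSum.lof ℤ ℕ X 1) ⊔
    LinearMap.range ((TensorProduct.mk ℤ H H).flip 1 ∘ₗ e.toLinearMap ∘ₗ DirectSum.lof ℤ ℕ X 1)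
  have hP : Coalgebra.comul (R := ℤ) (e (DirectSum.of X 1 x)) ∈ P := by
    refine mem_of_components e P _ fun k l => ?_
    by_cases hkl : k + l = 1
    · generalize TensorProduct.map (DirectSum.component ℤ ℕ X k ∘ₗ e.symm.toLinearMap)
        (DirectSum.component ℤ ℕ X l ∘ₗ e.symm.toLinearMap)
        (Coalgebra.comul (R := ℤ) (e (DirectSum.of X 1 x))) = w
      induction w using TensorProduct.induction_on with
      | zero => simp
      | add z w hz hw => rw [map_add]; exact P.add_mem hz hw
      | tmul y z =>
        rw [TensorProduct.map_tmul]
        obtain ⟨rfl, rfl⟩ | ⟨rfl, rfl⟩ : (k = 0 ∧ l = 1) ∨ (k = 1 ∧ l = 0) := by omega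
        · obtain ⟨c, hc⟩ := hsm y
          refine Submodule.mem_sup_left ⟨c • z, ?_⟩
          rw [LinearMap.map_smul]
          change c • ((1 : H) ⊗ₜ[ℤ] e (DirectSum.of X 1 z)) =
            e (DirectSum.of X 0 y) ⊗ₜ[ℤ] e (DirectSum.of X 1 z)
          rw [hc, TensorProduct.smul_tmul']
        · obtain ⟨c, hc⟩ := hsm z
          refine Submodule.mem_sup_right ⟨c • y, ?_⟩
          rw [LinearMap.map_smul]
          change c • (e (DirectSum.of X 1 y) ⊗ₜ[ℤ] (1 : H)) =
            e (DirectSum.of X 1 y) ⊗ₜ[ℤ] e (DirectSum.of X 0 z)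
          rw [hc, TensorProduct.tmul_smul]
    · rw [hcomul 1 k l x hkl, map_zero]
      exact P.zero_mem
  obtain ⟨_, ⟨y, rfl⟩, _, ⟨y', rfl⟩, h⟩ := Submodule.mem_sup.1 hP
  change (1 : H) ⊗ₜ[ℤ] e (DirectSum.of X 1 y) + e (DirectSum.of X 1 y') ⊗ₜ[ℤ] (1 : H) = _ at h
  -- The coproduct is now `1 ⊗ y + y' ⊗ 1`. The two counit axioms give `y + c • 1 = x` and `y' + c'
  -- • 1 = x` for integers `c`, `c'`. As `1` has degree zero, comparing degree-one parts yields `y =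
  -- x = y'`.
  have degree (v : X 1) (c : ℤ)
      (hv : e (DirectSum.of X 1 v) + c • (1 : H) = e (DirectSum.of X 1 x)) : v = x := by
    rw [hx₀, ← map_of_zsmul, ← map_add, EmbeddingLike.apply_eq_iff_eq] at hv
    have h1 := congrArg (fun g : ⨁ n, X n => g 1) hv
    rwa [DirectSum.add_apply, DirectSum.of_eq_same, DirectSum.of_eq_same,
      DirectSum.of_eq_of_ne _ _ _ one_ne_zero, add_zero] at h1
  have hl := congrArg (TensorProduct.lid ℤ H) (Coalgebra.rTensor_counit_comul (R := ℤ)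
    (e (DirectSum.of X 1 x)))
  have hr := congrArg (TensorProduct.rid ℤ H) (Coalgebra.lTensor_counit_comul (R := ℤ)
    (e (DirectSum.of X 1 x)))
  rw [← h] at hl hr ⊢
  simp only [map_add, LinearMap.rTensor_tmul, LinearMap.lTensor_tmul, Bialgebra.counit_one,
    TensorProduct.lid_tmul, TensorProduct.rid_tmul, one_smul] at hl hr
  rw [degree y _ hl, degree y' _ ((add_comm _ _).trans hr)]

/-- Used to see that the powers of a degree-one class other than the first are orthogonal to degree
one. -/
theorem exists_pow_eq_of [Module ℤ H] (e : (⨁ n, X n) ≃ₗ[ℤ] H)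
    (hmul : ∀ k l (x : X k) (y : X l), ∃ z : X (k + l),
      e (DirectSum.of X k x) * e (DirectSum.of X l y) = e (DirectSum.of X (k + l) z))
    (x : X 1) (n : ℕ) : ∃ y : X n, e (DirectSum.of X 1 x) ^ n = e (DirectSum.of X n y) := by
  induction n with
  | zero => simpa using exists_one_eq_of_zero e hmul
  | succ n ih =>
    obtain ⟨y, hy⟩ := ih
    rw [pow_succ, hy]
    exact hmul n 1 y x

end Graded

/-! ### Pairing powers with powers of a primitive element -/

/-- If `b` is primitive and `a` is orthogonal to all powers of `b` other than the first, then
`⟨a ^ n, b ^ n⟩ = n! ⟨a, b⟩ ^ n`. -/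
theorem IsHopfPairing.pow_pow {H H' : Type v} [Semiring H] [Bialgebra ℤ H] [Semiring H']
    [Bialgebra ℤ H'] {π : H →ₗ[ℤ] H' →ₗ[ℤ] ℤ} (hπ : IsHopfPairing π) (a : H) (b : H')
    (hb : Coalgebra.comul (R := ℤ) b = 1 ⊗ₜ[ℤ] b + b ⊗ₜ[ℤ] 1)
    (hab : ∀ k, k ≠ 1 → π a (b ^ k) = 0) (n : ℕ) :
    π (a ^ n) (b ^ n) = n.factorial * π a b ^ n := by
  induction n with
  | zero => simp [hπ.one_left]
  | succ n ih =>
    -- The two summands of the coproduct of `b` commute even when `H'` does not, so the binomial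
    -- theorem applies.
    have hcomm : Commute ((b : H') ⊗ₜ[ℤ] (1 : H')) ((1 : H') ⊗ₜ[ℤ] b) := by
      simp [Commute, SemiconjBy]
    have hΔ : Coalgebra.comul (R := ℤ) (b ^ (n + 1)) = (b ⊗ₜ[ℤ] 1 + 1 ⊗ₜ[ℤ] b) ^ (n + 1) := by
      rw [Bialgebra.comul_pow, hb, add_comm]
    rw [pow_succ' a, hπ.mul_left, hΔ, hcomm.add_pow, map_sum]
    have hterm : ∀ k, tensorPairing π (a ⊗ₜ[ℤ] (a ^ n)) ((b ⊗ₜ[ℤ] 1) ^ k * (1 ⊗ₜ[ℤ] b) ^ (n + 1 - k) *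
        ((n + 1).choose k : H' ⊗[ℤ] H')) =
        (n + 1).choose k * (π a (b ^ k) * π (a ^ n) (b ^ (n + 1 - k))) := by
      intro k
      rw [← nsmul_eq_mul', map_nsmul, nsmul_eq_mul, Algebra.TensorProduct.tmul_pow,
        Algebra.TensorProduct.tmul_pow, Algebra.TensorProduct.tmul_mul_tmul]
      simp [tensorPairing]
    simp only [hterm]
    -- The `k`-th term has the factor `π a (b ^ k)`, which vanishes unless `k = 1`.
    rw [Finset.sum_eq_single 1]
    · rw [pow_one, Nat.choose_one_right, Nat.add_sub_cancel, ih, Nat.factorial_succ]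
      push_cast
      ring
    · intro k _ hk
      rw [hab k hk]
      ring
    · simp

/-! ### Regular modules and their induction -/

section Regular

variable {B : Type u} [Ring B] [Algebra ℂ B]

variable (B) in
/-- The regular module. -/
def regular : FGMod B := ⟨B⟩

theorem regular_projective : projMod (regular B) := inferInstanceAs (Module.Projective B B)

theorem projMod_punit : projMod (B := B) ⟨PUnit⟩ := inferInstanceAs (Module.Projective B PUnit.{u + 1})

variable (B) in
theorem homDim_regular [Module.Finite ℂ B] : homDim (regular B) (regular B) = Module.finrank ℂ B :=
  congrArg Nat.cast (LinearMap.ringLmapEquivSelf B ℂ B).finrank_eq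

variable {A C : Type u} [Ring A] [Algebra ℂ A] [Ring C] [Algebra ℂ C] [Module.Finite ℂ B]
  [Module.Finite ℂ C]

/-- Identifies the external tensor product of the regular modules with the regular module of `B ⊗
C`, whose underlying space is the same. -/
theorem regular_ext_smul (a : B ⊗[ℂ] C) (x : (regular B).ext (regular C)) :
    a • x = (a * (show B ⊗[ℂ] C from x) : B ⊗[ℂ] C) := by
  induction a using TensorProduct.induction_on with
  | zero => rw [zero_smul, zero_mul]; rfl
  | add a b ha hb => rw [add_smul, add_mul, ha, hb]; rfl
  | tmul b c =>
    induction x using TensorProduct.induction_on with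
    | zero =>
      exact (smul_zero (A := (regular B).ext (regular C)) _).trans (mul_zero (b ⊗ₜ[ℂ] c)).symm
    | add x y hx hy =>
      refine (smul_add (A := (regular B).ext (regular C)) _ _ _).trans ?_
      rw [hx, hy]
      exact (mul_add (b ⊗ₜ[ℂ] c) (x : B ⊗[ℂ] C) y).symm
    | tmul m n => exact (Algebra.TensorProduct.tmul_mul_tmul (R := ℂ) b m c n).symm

/-- The map `A ⊗_φ (B ⊗ C) → A`, `a ⊗ x ↦ a φ(x)`. -/
noncomputable def indRegularMap [Module.Finite ℂ A] (φ : B ⊗[ℂ] C →ₐ[ℂ] A) :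
    ((regular B).ext (regular C)).ind φ →ₗ[A] A :=
  indLift (X := A) φ (N := (regular B).ext (regular C)) φ.toLinearMap fun b n => by
    rw [regular_ext_smul]; exact map_mul φ _ _

/-- The inverse is `a ↦ a • u`, where `u` is the class of `1 ⊗ 1`: the defining relation moves any
`n = n • 1` across the tensor sign, so `a ⊗ n = a φ(n) ⊗ 1`. -/
theorem indRegularMap_bijective [Module.Finite ℂ A] (φ : B ⊗[ℂ] C →ₐ[ℂ] A) :
    Function.Bijective (indRegularMap φ) := by
  let N := (regular B).ext (regular C)
  let i : N := (1 : B ⊗[ℂ] C)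
  have hmk (a : A) (n : N) : indRegularMap φ (Submodule.Quotient.mk (a ⊗ₜ[ℂ] n)) =
      a * φ (show B ⊗[ℂ] C from n) := rfl
  let u : (A ⊗[ℂ] N) ⧸ indRel φ N := Submodule.Quotient.mk ((1 : A) ⊗ₜ[ℂ] i)
  have hsmul (a : A) : a • u = Submodule.Quotient.mk (a ⊗ₜ[ℂ] i) := by
    rw [show u = Submodule.Quotient.mk _ from rfl, ← Submodule.Quotient.mk_smul,
      TensorProduct.smul_tmul', smul_eq_mul, mul_one]
  -- `F` sends `t` to `indRegularMap φ [t] • u`. That it agrees with the quotient map says that `a ↦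
  -- a • u` is a left inverse, which gives injectivity.
  let F : A ⊗[ℂ] N →ₗ[A] ((A ⊗[ℂ] N) ⧸ indRel φ N) :=
    LinearMap.toSpanSingleton A _ u ∘ₗ indRegularMap φ ∘ₗ (indRel φ N).mkQ
  have hF (t : A ⊗[ℂ] N) : F t = (indRel φ N).mkQ t := by
    induction t using TensorProduct.induction_on with
    | zero => rw [map_zero, map_zero]
    | add x y hx hy => rw [map_add, map_add, hx, hy]
    | tmul a n =>
      let n' : B ⊗[ℂ] C := n
      have hn : n' • i = n := (regular_ext_smul n' i).trans (mul_one n')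
      refine (congrArg (· • u) (hmk a n)).trans ((hsmul (a * φ n')).trans ?_)
      exact (ind_mk_rel φ N a n' i).trans (congrArg (fun y => (indRel φ N).mkQ (a ⊗ₜ[ℂ] y)) hn)
  constructor
  · rw [injective_iff_map_eq_zero]
    intro x hx
    obtain ⟨x, rfl⟩ := (indRel φ N).mkQ_surjective x
    exact (hF x).symm.trans ((congrArg (· • u) hx).trans (zero_smul A u))
  · intro a
    refine ⟨Submodule.Quotient.mk (a ⊗ₜ[ℂ] i), (hmk a i).trans ?_⟩
    exact (congrArg (a * ·) (map_one φ)).trans (mul_one a)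

/-- Induction of the regular module of `B ⊗ C` gives the regular module. -/
noncomputable def indRegularEquiv [Module.Finite ℂ A] (φ : B ⊗[ℂ] C →ₐ[ℂ] A) :
    ((regular B).ext (regular C)).ind φ ≃ₗ[A] A :=
  LinearEquiv.ofBijective (indRegularMap φ) (indRegularMap_bijective φ)

end Regular

/-! ### The Grothendieck group in degree zero -/

/-- The Grothendieck group of `ℂ` is generated by the class of the regular module. -/
theorem G0.exists_zsmul_regular {B : Type u} [Ring B] [Algebra ℂ B] [Module.Finite ℂ B]
    (e : B ≃ₐ[ℂ] ℂ) (x : G0 B) :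
    ∃ a : ℤ, x = a • Groth.cls (P := allMod) (regular B) trivial := by
  have hB (b : B) : b = algebraMap ℂ B (e b) := by
    apply e.injective
    rw [e.commutes]
    rfl
  -- Induction on the dimension: a nonzero vector spans a copy of the regular module, and the
  -- quotient has dimension one less.
  have hcls : ∀ (d : ℕ) (M : FGMod B), Module.finrank ℂ M = d →
      ∃ a : ℤ, Groth.cls (P := allMod) M trivial =
        a • Groth.cls (P := allMod) (regular B) trivial := by
    intro d
    induction d with
    | zero =>
      intro M hM
      have := Module.finrank_zero_iff.1 hM
      -- For `M = 0` the sequence `0 → M → M → M → 0` is exact, so `[M] = [M] + [M]`.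
      have h := Groth.cls_exact (P := allMod) (L := M) (M := M) (N := M) trivial trivial trivial
        0 0 ⟨fun _ _ _ => Subsingleton.elim _ _, fun x => ⟨fun _ => ⟨x, Subsingleton.elim _ _⟩,
        fun _ => Subsingleton.elim _ _⟩, fun x => ⟨x, Subsingleton.elim _ _⟩⟩
      exact ⟨0, by simpa using h⟩
    | succ d ih =>
      intro M hM
      have : Nontrivial M := Module.nontrivial_of_finrank_pos (R := ℂ) (by omega)
      obtain ⟨m, hm⟩ := exists_ne (0 : M)
      let f : regular B →ₗ[B] M := LinearMap.toSpanSingleton B M m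
      have hf : Function.Injective f := by
        rw [injective_iff_map_eq_zero]
        intro b hb
        have h0 : (show B from b) • m = 0 := hb
        rw [hB b, algebraMap_smul, smul_eq_zero, or_iff_left hm] at h0
        rw [hB b]
        exact (congrArg (algebraMap ℂ B) h0).trans (map_zero _)
      let Q : FGMod B := ⟨M ⧸ LinearMap.range f⟩
      let g : M →ₗ[B] Q := (LinearMap.range f).mkQ
      have hfg : IsShortExact f g := ⟨hf, fun x => by
        change (LinearMap.range f).mkQ x = 0 ↔ x ∈ LinearMap.range f
        rw [← LinearMap.mem_ker, Submodule.ker_mkQ], (LinearMap.range f).mkQ_surjective⟩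
      have hrank := finrank_of_exact (f.restrictScalars ℂ) (g.restrictScalars ℂ) hfg.injective
        hfg.exact hfg.surjective
      have h1 : Module.finrank ℂ (regular B) = 1 :=
        e.toLinearEquiv.finrank_eq.trans (Module.finrank_self ℂ)
      obtain ⟨a, ha⟩ := ih Q (by rw [hM, h1] at hrank; push_cast at hrank; omega)
      refine ⟨1 + a, ?_⟩
      rw [Groth.cls_exact (P := allMod) trivial trivial trivial f g hfg, ha, add_smul, one_smul]
  obtain ⟨x, rfl⟩ := QuotientAddGroup.mk_surjective x
  induction x using FreeAbelianGroup.induction_on with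
  | zero => exact ⟨0, (zero_smul ℤ _).symm⟩
  | of M => exact hcls _ M.1 rfl
  | neg M h =>
    obtain ⟨a, ha⟩ := h
    exact ⟨-a, by rw [neg_smul, ← ha]; rfl⟩
  | add x y hx hy =>
    obtain ⟨a, ha⟩ := hx
    obtain ⟨b, hb⟩ := hy
    exact ⟨a + b, by rw [add_smul, ← ha, ← hb]; rfl⟩

/-! ### Pairings and products of the regular classes -/

namespace Tower

variable {A : ℕ → Type u} [∀ n, Ring (A n)] [∀ n, Algebra ℂ (A n)] [∀ n, Module.Finite ℂ (A n)]

theorem pairing_of_same (n : ℕ) (x : K0 (A n)) (y : G0 (A n)) :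
    pairing A (DirectSum.of _ n x) (DirectSum.of _ n y) = pairing₀ (A n) x y := by
  refine (LinearMap.congr_fun (DirectSum.toModule_lof ℤ (M := fun n => K0 (A n)) n x) _).trans ?_
  exact congrArg (pairing₀ (A n) x) (DirectSum.of_eq_same (β := fun n => G0 (A n)) n y)

theorem pairing_of_ne (m n : ℕ) (h : m ≠ n) (x : K0 (A m)) (y : G0 (A n)) :
    pairing A (DirectSum.of _ m x) (DirectSum.of _ n y) = 0 := by
  refine (LinearMap.congr_fun (DirectSum.toModule_lof ℤ (M := fun n => K0 (A n)) m x) _).trans ?_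
  refine (congrArg (pairing₀ (A m) x)
    (DirectSum.of_eq_of_ne (β := fun n => G0 (A n)) n m y h)).trans (map_zero _)

variable (T : Tower A)

theorem indK_regular (k l : ℕ) :
    T.indK k l (extK A k l (Groth.cls (regular (A k)) regular_projective ⊗ₜ[ℤ]
      Groth.cls (regular (A l)) regular_projective)) =
        Groth.cls (regular (A (k + l))) regular_projective := by
  rw [extK, Groth.ext_cls, indK, Groth.ind_cls]
  exact Groth.cls_eq_of_equiv _ _ (indRegularEquiv _) projMod_punit

theorem indG_regular (k l : ℕ) :
    T.indG k l (extG A k l (Groth.cls (regular (A k)) trivial ⊗ₜ[ℤ]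
      Groth.cls (regular (A l)) trivial)) = Groth.cls (regular (A (k + l))) trivial := by
  refine (congrArg (T.indG k l) (Groth.ext_cls (P := allMod) (Q := allMod) (R := allMod)
    (fun _ _ _ _ => trivial) _ _ _ _)).trans ?_
  refine (Groth.ind_cls (T.ρ k l) (T.rightProjective k l) (P := allMod) (Q := allMod)
    (fun _ _ => trivial) _ _).trans ?_
  exact Groth.cls_eq_of_equiv _ _ (indRegularEquiv _) trivial

end Tower

/-- If the classes `c n` multiply as `c k * c l = c (k + l)`, then `c n` is the power of `c 1`. -/
theorem pow_eq_of_mul {X : ℕ → Type v} [∀ n, AddCommGroup (X n)] {H : Type v} [Semiring H]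
    [Module ℤ H] (e : (⨁ n, X n) ≃ₗ[ℤ] H) (c : ∀ n, X n)
    (hc : ∀ k l, e (DirectSum.of X k (c k)) * e (DirectSum.of X l (c l)) =
      e (DirectSum.of X (k + l) (c (k + l)))) (n : ℕ) :
    e (DirectSum.of X 1 (c 1)) ^ (n + 1) = e (DirectSum.of X (n + 1) (c (n + 1))) := by
  induction n with
  | zero => rw [zero_add, pow_one]
  | succ n ih => rw [pow_succ, ih, hc]

end AlgTower

/-! ### The dimension formula -/

theorem theorem1 (A : ℕ → Type u) [∀ n, Ring (A n)] [∀ n, Algebra ℂ (A n)]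
    [∀ n, Module.Finite ℂ (A n)] (T : AlgTower.Tower A) (hT : T.FormsDualHopfPair) (n : ℕ) :
    Module.finrank ℂ (A n) = Module.finrank ℂ (A 1) ^ n * n.factorial := by
  obtain ⟨HK, HG, _, _, _, _, eK, eG, hK, hG, hπ⟩ := hT
  obtain ⟨e₀⟩ := T.zero_equiv
  -- Degree zero is handled by `A 0 ≅ ℂ`, since the class of `A n` is identified with an `n`-th
  -- power only for positive `n`.
  rcases n with _ | n
  · simpa using e₀.toLinearEquiv.finrank_eq.trans (Module.finrank_self ℂ)
  let cK (n : ℕ) : AlgTower.K0 (A n) := AlgTower.Groth.cls (AlgTower.regular (A n)) AlgTower.regular_projective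
  let cG (n : ℕ) : AlgTower.G0 (A n) := AlgTower.Groth.cls (AlgTower.regular (A n)) trivial
  have hdim (n : ℕ) : ((AlgTower.Tower.pairing A).compl₁₂ eK.symm.toLinearMap eG.symm.toLinearMap)
      (eK (DirectSum.of _ n (cK n))) (eG (DirectSum.of _ n (cG n))) = Module.finrank ℂ (A n) := by
    rw [LinearMap.compl₁₂_apply, LinearEquiv.coe_coe, LinearEquiv.coe_coe,
      LinearEquiv.symm_apply_apply, LinearEquiv.symm_apply_apply, AlgTower.Tower.pairing_of_same]
    exact (AlgTower.pairing₀_cls _ _ _ _).trans (AlgTower.homDim_regular _)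
  have hmulK (k l : ℕ) := (hK.mul k l (cK k) (cK l)).trans
    (congrArg (fun x => eK (DirectSum.of _ (k + l) x)) (T.indK_regular k l))
  have hmulG (k l : ℕ) := (hG.mul k l (cG k) (cG l)).trans
    (congrArg (fun x => eG (DirectSum.of _ (k + l) x)) (T.indG_regular k l))
  have hmul : ∀ k l (x : AlgTower.G0 (A k)) (y : AlgTower.G0 (A l)), ∃ z : AlgTower.G0 (A (k + l)),
      eG (DirectSum.of _ k x) * eG (DirectSum.of _ l y) = eG (DirectSum.of _ (k + l) z) :=
    fun k l x y => ⟨_, hG.mul k l x y⟩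
  have hprim := AlgTower.comul_of_one eG hmul hG.comul_of_ne (cG 0) (AlgTower.G0.exists_zsmul_regular e₀) (cG 1)
  -- The `k`-th power of the class of `A 1` has degree `k`, and different degrees are orthogonal.
  have horth (k : ℕ) (hk : k ≠ 1) : ((AlgTower.Tower.pairing A).compl₁₂ eK.symm.toLinearMap eG.symm.toLinearMap)
      (eK (DirectSum.of _ 1 (cK 1))) (eG (DirectSum.of _ 1 (cG 1)) ^ k) = 0 := by
    obtain ⟨y, hy⟩ := AlgTower.exists_pow_eq_of eG hmul (cG 1) k
    rw [hy, LinearMap.compl₁₂_apply, LinearEquiv.coe_coe, LinearEquiv.coe_coe,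
      LinearEquiv.symm_apply_apply, LinearEquiv.symm_apply_apply, AlgTower.Tower.pairing_of_ne _ _ hk.symm]
  -- Both sides become dimensions once the powers are replaced by the classes of the regular
  -- modules.
  have h := hπ.pow_pow _ _ hprim horth (n + 1)
  rw [AlgTower.pow_eq_of_mul eK cK hmulK, AlgTower.pow_eq_of_mul eG cG hmulG, hdim, hdim, mul_comm] at h
  exact_mod_cast h
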